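/- Let $R$ be a commutative ring and let $G$ be a finite directed graph with vertex set $V$ and edge set $E\subseteq V\times V$ that is connected (as an undirected graph, i.e. forgetting the directions of the edges). For vertices $x,y$ let $d(x,y)\in\mathbb{N}\cup\{\infty\}$ be the minimal number of edges of a directed path from $x$ to $y$ (the constant path included), and put $\mathrm{len}(x_0,\dots,x_k)=\sum_{i=0}^{k-1}d(x_i,x_{i+1})$. Write $\partial_i$ for the operation of forgetting the $i$-th entry of a tuple. For $k,\ell\ge 0$ let $\mathrm{EMC}_{k,\ell}(G)$ be the free $R$-module on the tuples $(x_0,\dots,x_k)$ of pairwise distinct vertices with $\mathrm{len}(x_0,\dots,x_k)=\ell$, with differential $\sum_{i=1}^{k-1}(-1)^i\partial_i$, where a face whose length is not $\ell$ is replaced by $0$; let $\mathrm{EMH}_{k,\ell}(G)=H_k(\mathrm{EMC}_{*,\ell}(G))$ be the eulerian magnitude homology of $G$. Assume that $G$ is regularly diagonal over $R$, i.e. $\mathrm{EMH}_{k,\ell}(G)=0$ for all $k\ne\ell$. Let $\mathcal{A}^\iota_n(G)$ be the free $R$-module on the tuples $(x_0,\dots,x_n)$ of pairwise distinct vertices with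 $(x_i,x_{i+1})\in E$ for all $i<n$, let $\partial=\sum_{i=0}^{n}(-1)^i\partial_i$, and let $\Omega^\iota_n(G)=\{a\in\mathcal{A}^\iota_n(G) : \partial a\in\mathcal{A}^\iota_{n-1}(G)\}$ (with $\Omega^\iota_0(G)=\mathcal{A}^\iota_0(G)$). The regular path homology of $G$ is the homology of the chain complex $(\Omega^\iota_*(G),\partial)$. Let $\mathrm{Inj}(G)$ be the complex of injective words on $G$: its $n$-simplices are the tuples $(x_0,\dots,x_n)$ of pairwise distinct vertices such that for all $i<j$ there is a directed path in $G$ from $x_i$ to $x_j$, with faces $\partial_i$. Let $\mathrm{Pre}(G)$ be the reachability preorder of $G$, i.e. the directed graph on $V$ with an edge $(x,y)$ whenever there is a (possibly constant) directed path from $x$ to $y$ in $G$; and for a directed graph $H$ let $\mathrm{dFl}(H)$ be its directed flag complex, whose $n$-simplices are the tuples $(x_0,\dots,x_n)$ of pairwise distinct vertices such that $(x_i,x_j)$ is an edge of $H$ for all $i<j$. The homology of these complexes with coefficients in $R$ is that of the free modules on the $n$-simplices with differential $\sum_{i=0}^n(-1)^i\partial_i$. Then for every $n\ge 0$ there are isomorphisms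 of $R$-modules $$H_n(\Omega^\iota_*(G),\partial)\;\cong\; H_n(\mathrm{Inj}(G);R)\qquad\text{and}\qquad H_n(\Omega^\iota_*(G),\partial)\;\cong\; H_n(\mathrm{dFl}(\mathrm{Pre}(G));R).$$ -/

import Mathlib

open CategoryTheory

namespace EulerianMagnitude

universe u v

section Chains

variable (R : Type u) [CommRing R] {V : Type v}

/-- The `i`-th face of a tuple `(x_0, …, x_{n+1})`: forget the `i`-th entry. -/
def face {n : ℕ} (i : Fin (n + 2)) (x : Fin (n + 2) → V) : Fin (n + 1) → V :=
  fun j => x (i.succAbove j)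

variable (V) in
/-- The free `R`-module on the tuples `(x_0, …, x_n)` of elements of `V`
(the elementary `n`-paths). -/
abbrev Tuples (n : ℕ) : Type max u v := (Fin (n + 1) → V) →₀ R

/-- The signed sum `∑_{i ∈ s} (-1)^i ∂_i` of the face maps with index in `s`. -/
noncomputable def signedFaces {n : ℕ} (s : Finset (Fin (n + 2))) :
    Tuples R V (n + 1) →ₗ[R] Tuples R V n :=
  Finsupp.linearCombination R fun x : Fin (n + 2) → V =>
    ∑ i ∈ s, (-1 : R) ^ (i : ℕ) • Finsupp.single (face i x) (1 : R)

/-- The differential `∂ = ∑_{i=0}^{n+1} (-1)^i ∂_i` on elementary paths. -/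
noncomputable def boundary (n : ℕ) : Tuples R V (n + 1) →ₗ[R] Tuples R V n :=
  signedFaces R Finset.univ

lemma signedFaces_single {n : ℕ} (s : Finset (Fin (n + 2))) (x : Fin (n + 2) → V) :
    signedFaces R s (Finsupp.single x 1) =
      ∑ i ∈ s, (-1 : R) ^ (i : ℕ) • Finsupp.single (face i x) (1 : R) := by
  simp [signedFaces]

lemma boundary_boundary (n : ℕ) (a : Tuples R V (n + 2)) :
    boundary R n (boundary R (n + 1) a) = 0 := by
  suffices h : boundary R n ∘ₗ boundary R (n + 1) = (0 : Tuples R V (n + 2) →ₗ[R] _) from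
    LinearMap.congr_fun h a
  refine Finsupp.lhom_ext' fun x => LinearMap.ext_ring ?_
  simp only [LinearMap.comp_apply, Finsupp.lsingle_apply, LinearMap.zero_apply, boundary,
    signedFaces_single, map_sum, map_smul, Finset.smul_sum, smul_smul]
  rw [← Finset.sum_product']
  refine Finset.sum_involution (fun p _ => (p.1.succAbove p.2, p.2.predAbove p.1)) ?_ ?_ ?_ ?_
  · rintro ⟨i, j⟩ -
    have hf : face (j.predAbove i) (face (i.succAbove j) x) = face j (face i x) := by
      funext k
      exact congrArg x (Fin.succAbove_succAbove_succAbove_predAbove i j k)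
    have hs := Fin.neg_one_pow_succAbove_add_predAbove (R := R) i j
    simp only [hf, ← pow_add, ← add_smul]
    rw [hs]
    simp
  · rintro ⟨i, j⟩ - - h
    exact Fin.succAbove_ne i j (congrArg Prod.fst h)
  · simp
  · rintro ⟨i, j⟩ -
    exact Prod.ext (Fin.succAbove_succAbove_predAbove i j) (Fin.predAbove_predAbove_succAbove i j)

/-- The chain complex formed by submodules `M n` of the modules of elementary `n`-paths,
stable under `∂`. -/
noncomputable def subcomplex (M : ∀ n, Submodule R (Tuples R V n))
    (hM : ∀ n, ∀ a ∈ M (n + 1), boundary R n a ∈ M n) : ChainComplex (ModuleCat.{max u v} R) ℕ :=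
  ChainComplex.of (fun n => ModuleCat.of R (M n))
    (fun n => ModuleCat.ofHom ((boundary R n).restrict (hM n)))
    (fun n => by
      refine ModuleCat.hom_ext (LinearMap.ext fun a => Subtype.ext ?_)
      exact boundary_boundary R n a.1)

end Chains

section OrderedComplex

variable {V : Type v}

/-- An ordered simplicial complex: the `n`-simplices are tuples `(x_0, …, x_n)` of distinct
vertices, and forgetting an entry of a simplex gives a simplex. -/
structure OrderedComplex (V : Type v) where
  simplices : ∀ n : ℕ, Set (Fin (n + 1) → V)
  injective : ∀ n, ∀ x ∈ simplices n, Function.Injective x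
  face_mem : ∀ n, ∀ x ∈ simplices (n + 1), ∀ i, face i x ∈ simplices n

variable (R : Type u) [CommRing R]

lemma OrderedComplex.boundary_mem (K : OrderedComplex V) (n : ℕ) (a : Tuples R V (n + 1))
    (ha : a ∈ Finsupp.supported R R (K.simplices (n + 1))) :
    boundary R n a ∈ Finsupp.supported R R (K.simplices n) := by
  rw [boundary, signedFaces, Finsupp.linearCombination_apply]
  refine Submodule.sum_mem _ fun x hx => Submodule.smul_mem _ _ <|
    Submodule.sum_mem _ fun i _ => Submodule.smul_mem _ _ ?_
  exact Finsupp.single_mem_supported R 1 (K.face_mem n x (ha hx) i)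

/-- The simplicial chain complex of an ordered simplicial complex: in degree `n` the free module
on the `n`-simplices, with the alternating sum of the face maps as differential. -/
noncomputable def OrderedComplex.chains (K : OrderedComplex V) :
    ChainComplex (ModuleCat.{max u v} R) ℕ :=
  subcomplex R (fun n => Finsupp.supported R R (K.simplices n)) (K.boundary_mem R)

end OrderedComplex

section Digraphs

variable {V : Type v} (G : Digraph V)

/-- `HasWalk G n x y`: there is a directed path with `n` edges from `x` to `y` in `G`. -/
inductive HasWalk : ℕ → V → V → Prop
  | nil (x : V) : HasWalk 0 x x
  | cons {n : ℕ} {x y z : V} : G.Adj x y → HasWalk n y z → HasWalk (n + 1) x z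

/-- There is a directed path from `x` to `y`, possibly the constant one. -/
def Reaches (x y : V) : Prop := ∃ n, HasWalk G n x y

/-- The directed path distance: the least number of edges of a directed path from `x` to `y`,
and `∞` if there is none. -/
noncomputable def dist (x y : V) : ℕ∞ := ⨅ (n : ℕ) (_ : HasWalk G n x y), (n : ℕ∞)

/-- The length of a tuple of vertices; it is finite iff all the consecutive distances are. -/
noncomputable def len {n : ℕ} (x : Fin (n + 1) → V) : ℕ∞ :=
  ∑ i : Fin n, dist G (x i.castSucc) (x i.succ)

/-- The complex of injective words on `G`. -/
def injWords : OrderedComplex V where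
  simplices _ := {x | Function.Injective x ∧ ∀ i j, i < j → Reaches G (x i) (x j)}
  injective _ _ hx := hx.1
  face_mem _ _ hx i := ⟨hx.1.comp Fin.succAbove_right_injective,
    fun _ _ hjk => hx.2 _ _ (Fin.strictMono_succAbove i hjk)⟩

/-- The directed flag complex of `G`: its `n`-simplices are the ordered `(n+1)`-cliques. -/
def dirFlag : OrderedComplex V where
  simplices _ := {x | Function.Injective x ∧ ∀ i j, i < j → G.Adj (x i) (x j)}
  injective _ _ hx := hx.1
  face_mem _ _ hx i := ⟨hx.1.comp Fin.succAbove_right_injective,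
    fun _ _ hjk => hx.2 _ _ (Fin.strictMono_succAbove i hjk)⟩

/-- The reachability preorder of `G`, viewed as a directed graph. -/
def reachPre : Digraph V where
  Adj x y := Reaches G x y

/-- The strongly regular allowed elementary `n`-paths of `G`: tuples of distinct vertices such
that any two consecutive ones span a directed edge. -/
def allowedPaths (n : ℕ) : Set (Fin (n + 1) → V) :=
  {x | Function.Injective x ∧ ∀ i : Fin n, G.Adj (x i.castSucc) (x i.succ)}

/-- The generators of the eulerian magnitude chains in bidegree `(k, l)`: tuples of distinct
vertices of length `l`. -/
def eulerianTuples (k l : ℕ) : Set (Fin (k + 1) → V) :=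
  {x | Function.Injective x ∧ len G x = l}

variable (R : Type u) [CommRing R]

/-- The `∂`-invariant strongly regular allowed `n`-paths: linear combinations `a` of strongly
regular allowed paths such that `∂ a` is again such a combination. -/
noncomputable def regularPaths : ∀ n, Submodule R (Tuples R V n)
  | 0 => Finsupp.supported R R (allowedPaths G 0)
  | n + 1 => Finsupp.supported R R (allowedPaths G (n + 1)) ⊓
      (Finsupp.supported R R (allowedPaths G n)).comap (boundary R n)

lemma boundary_mem_regularPaths (n : ℕ) (a : Tuples R V (n + 1))
    (ha : a ∈ regularPaths G R (n + 1)) : boundary R n a ∈ regularPaths G R n := by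
  cases n with
  | zero => exact ha.2
  | succ n =>
    refine ⟨ha.2, ?_⟩
    change boundary R n (boundary R (n + 1) a) ∈ Finsupp.supported R R (allowedPaths G n)
    rw [boundary_boundary]
    exact Submodule.zero_mem _

/-- The chain complex computing regular path homology. -/
noncomputable def regularPathComplex : ChainComplex (ModuleCat.{max u v} R) ℕ :=
  subcomplex R (regularPaths G R) (boundary_mem_regularPaths G R)

/-- The magnitude differential `∑_{i=1}^{k} (-1)^i ∂_i` from bidegree `(k+1, l)` to `(k, l)`:
only inner entries are forgotten, and faces whose length is not `l` are replaced by `0`. -/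
noncomputable def eulerianBoundary (l k : ℕ) :
    Finsupp.supported R R (eulerianTuples G (k + 1) l) →ₗ[R]
      Finsupp.supported R R (eulerianTuples G k l) :=
  letI := Classical.decPred (· ∈ eulerianTuples G k l)
  Finsupp.restrictDom R R (eulerianTuples G k l) ∘ₗ
    signedFaces R (Finset.univ.filter fun i => i ≠ 0 ∧ i ≠ Fin.last (k + 1)) ∘ₗ
    (Finsupp.supported R R (eulerianTuples G (k + 1) l)).subtype

lemma HasWalk.trans {m n : ℕ} {x y z : V} (h : HasWalk G m x y) (h' : HasWalk G n y z) :
    HasWalk G (m + n) x z := by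
  induction h with
  | nil => simpa using h'
  | cons ha _ ih => rw [Nat.add_right_comm]; exact .cons ha (ih h')

lemma exists_hasWalk {x y : V} (h : dist G x y ≠ ⊤) : ∃ n, HasWalk G n x y ∧ dist G x y = n := by
  classical
  have hex : ∃ n, HasWalk G n x y := by
    by_contra hc
    push Not at hc
    exact h (by simp [dist, hc])
  refine ⟨Nat.find hex, Nat.find_spec hex, le_antisymm ?_ ?_⟩
  · exact iInf₂_le (f := fun (n : ℕ) (_ : HasWalk G n x y) => (n : ℕ∞)) _ (Nat.find_spec hex)
  · exact le_iInf₂ fun n hn => by exact_mod_cast Nat.find_min' hex hn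

lemma dist_triangle (x y z : V) : dist G x z ≤ dist G x y + dist G y z := by
  by_cases h : dist G x y = ⊤
  · simp [h]
  by_cases h' : dist G y z = ⊤
  · simp [h']
  obtain ⟨m, hm, hm'⟩ := exists_hasWalk G h
  obtain ⟨n, hn, hn'⟩ := exists_hasWalk G h'
  rw [hm', hn']
  exact_mod_cast iInf₂_le (f := fun (n : ℕ) (_ : HasWalk G n x z) => (n : ℕ∞))
    (m + n) (hm.trans G hn)

lemma dist_pos {x y : V} (h : x ≠ y) : 0 < dist G x y := by
  rw [pos_iff_ne_zero]
  intro h0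
  obtain ⟨n, hn, hn'⟩ := exists_hasWalk G (x := x) (y := y) (by simp [h0])
  rw [h0] at hn'
  obtain rfl : n = 0 := by exact_mod_cast hn'.symm
  cases hn
  exact h rfl

lemma len_succ {n : ℕ} (x : Fin (n + 2) → V) :
    len G x = dist G (x 0) (x 1) + len G (face 0 x) := by
  simp [len, Fin.sum_univ_succ, face]

lemma len_castSucc {n : ℕ} (x : Fin (n + 2) → V) :
    len G x = len G (face (Fin.last _) x) +
      dist G (x (Fin.last n).castSucc) (x (Fin.last (n + 1))) := by
  simp [len, Fin.sum_univ_castSucc, face]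

lemma len_face_le {n : ℕ} (i : Fin (n + 2)) (x : Fin (n + 2) → V) :
    len G (face i x) ≤ len G x := by
  induction n with
  | zero => simp [len]
  | succ n ih =>
    refine Fin.cases ?_ (fun j => ?_) i
    · rw [len_succ G x]
      exact le_add_self
    · have key : face 0 (face j.succ x) = face j (face 0 x) := by
        funext k
        simp [face]
      rw [len_succ G x, len_succ G (face j.succ x), key]
      refine Fin.cases ?_ (fun j => ?_) j
      · rw [len_succ G (face 0 x), ← add_assoc]
        gcongr
        exact dist_triangle G _ _ _
      · exact add_le_add le_rfl (ih _ _)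

lemma len_face_lt {n l : ℕ} {x : Fin (n + 2) → V} (hx : x ∈ eulerianTuples G (n + 1) l)
    {i : Fin (n + 2)} (hi : ¬ (i ≠ 0 ∧ i ≠ Fin.last (n + 1))) : len G (face i x) < l := by
  obtain ⟨hinj, hl⟩ := hx
  refine lt_of_le_of_ne (hl ▸ len_face_le G i x) fun h => ?_
  rw [not_and_or, not_not, not_not] at hi
  rcases hi with rfl | rfl
  · have h1 := len_succ G x
    have h2 := dist_pos G (hinj.ne (show (0 : Fin (n + 2)) ≠ 1 by simp))
    rw [hl, h] at h1
    generalize dist G (x 0) (x 1) = d at *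
    cases d with
    | top => simp at h1
    | coe d => norm_cast at *; omega
  · have h1 := len_castSucc G x
    have h2 := dist_pos G (hinj.ne (Fin.castSucc_lt_last (Fin.last n)).ne)
    rw [hl, h] at h1
    generalize dist G (x (Fin.last n).castSucc) (x (Fin.last (n + 1))) = d at *
    cases d with
    | top => simp at h1
    | coe d => norm_cast at *; omega

open Classical in
lemma eulerianBoundary_eq (l k : ℕ) (a : Finsupp.supported R R (eulerianTuples G (k + 1) l)) :
    eulerianBoundary G R l k a =
      Finsupp.restrictDom R R (eulerianTuples G k l) (boundary R k a.1) := by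
  obtain ⟨a, ha⟩ := a
  simp only [eulerianBoundary, LinearMap.comp_apply, Submodule.subtype_apply, boundary, signedFaces,
    Finsupp.linearCombination_apply, Finsupp.sum, map_sum, map_smul]
  refine Finset.sum_congr rfl fun x hx => congrArg _ ?_
  convert Finset.sum_subset (Finset.subset_univ _) fun i _ hi => ?_
  rw [Finset.mem_filter_univ] at hi
  have hlt := len_face_lt G (ha hx) hi
  refine smul_eq_zero_of_right _ (Subtype.ext ?_)
  exact Finsupp.filter_single_of_neg _ fun hm => hlt.ne hm.2

open Classical in
lemma restrictDom_boundary_eq_zero (l k : ℕ) (c : Tuples R V (k + 1))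
    (hc : ∀ x ∈ c.support, len G x < l) :
    Finsupp.restrictDom R R (eulerianTuples G k l) (boundary R k c) = 0 := by
  simp only [boundary, signedFaces, Finsupp.linearCombination_apply, Finsupp.sum, map_sum, map_smul]
  refine Finset.sum_eq_zero fun x hx => smul_eq_zero_of_right _ <|
    Finset.sum_eq_zero fun i _ => smul_eq_zero_of_right _ (Subtype.ext ?_)
  exact Finsupp.filter_single_of_neg _
    fun hm => ((len_face_le G i x).trans_lt (hc x hx)).ne hm.2

lemma boundary_mem_len_le (l k : ℕ) (a : Tuples R V (k + 1))
    (ha : a ∈ Finsupp.supported R R (eulerianTuples G (k + 1) l)) :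
    boundary R k a ∈ Finsupp.supported R R {x | Function.Injective x ∧ len G x ≤ l} := by
  rw [boundary, signedFaces, Finsupp.linearCombination_apply]
  refine Submodule.sum_mem _ fun x hx => Submodule.smul_mem _ _ <|
    Submodule.sum_mem _ fun i _ => Submodule.smul_mem _ _ ?_
  exact Finsupp.single_mem_supported R 1 ⟨(ha hx).1.comp Fin.succAbove_right_injective,
    (len_face_le G i x).trans (ha hx).2.le⟩

lemma eulerianBoundary_comp (l k : ℕ) :
    eulerianBoundary G R l k ∘ₗ eulerianBoundary G R l (k + 1) = 0 := by
  classical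
  refine LinearMap.ext fun a => ?_
  rw [LinearMap.comp_apply, eulerianBoundary_eq, eulerianBoundary_eq, LinearMap.zero_apply]
  set b := boundary R (k + 1) a.1 with hb
  have hsplit : (Finsupp.restrictDom R R (eulerianTuples G (k + 1) l) b : Tuples R V (k + 1)) =
      b - b.filter (fun x => x ∉ eulerianTuples G (k + 1) l) :=
    eq_sub_of_add_eq (Finsupp.filter_add_filter_not b _)
  have hzero := restrictDom_boundary_eq_zero G R l k
    (b.filter (fun x => x ∉ eulerianTuples G (k + 1) l)) fun x hx => by
      rw [Finsupp.support_filter, Finset.mem_filter] at hx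
      have hx' := boundary_mem_len_le G R l (k + 1) a.1 a.2 hx.1
      exact lt_of_le_of_ne hx'.2 fun h => hx.2 ⟨hx'.1, h⟩
  rw [hsplit, map_sub, map_sub, hzero, hb, boundary_boundary, map_zero]
  exact sub_self _

/-- The eulerian magnitude chain complex `EMC_{*,l}(G)`. -/
noncomputable def eulerianComplex (l : ℕ) : ChainComplex (ModuleCat.{max u v} R) ℕ :=
  ChainComplex.of (fun k => ModuleCat.of R (Finsupp.supported R R (eulerianTuples G k l)))
    (fun k => ModuleCat.ofHom (eulerianBoundary G R l k))
    (fun k => by rw [← ModuleCat.ofHom_comp, eulerianBoundary_comp]; rfl)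

/-- `G` is regularly diagonal (over `R`): its eulerian magnitude homology `EMH_{k,l}(G)` vanishes
for all `k ≠ l`. -/
def RegularlyDiagonal : Prop :=
  ∀ k l : ℕ, k ≠ l → Limits.IsZero ((eulerianComplex G R l).homology k)

end Digraphs

end EulerianMagnitude

/-!
Filter the chains of `Inj(G)` by length. Forgetting an outer entry of a word strictly lowers its
length, so the `l`-th graded quotient is the eulerian magnitude complex `EMC_{*,l}(G)`; and the
allowed `n`-paths are exactly the injective words of length at most `n`. Let `c` be an `n`-chain of
length at most `l + 1`, with `l ≥ n`, whose boundary has length at most `l`. Its top part is a cycle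
of `EMC_{*,l+1}(G)` off the diagonal, hence a boundary, so `c` is homologous to a chain of length at
most `l`. Iterating, every cycle of `Inj(G)` relative to `Ω` is a relative boundary, and therefore
`Ω ⊆ Inj(G)` is a quasi-isomorphism. The complexes `Inj(G)` and `dFl(Pre(G))` coincide.
-/

namespace EulerianMagnitude

universe u v w

section Homology

lemma quasiIso_f_of_acyclic_X₃ {C ι : Type*} [Category* C] [Abelian C] {c : ComplexShape ι}
    {S : ShortComplex (HomologicalComplex C c)} (hS : S.ShortExact) (h : S.X₃.Acyclic) :
    QuasiIso S.f := by
  have hzero (i : ι) : Limits.IsZero (S.X₃.homology i) := (h i).isZero_homology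
  refine ⟨fun j => ?_⟩
  rw [quasiIsoAt_iff_isIso_homologyMap]
  have hepi : Epi (HomologicalComplex.homologyMap S.f j) :=
    (hS.homology_exact₂ j).epi_f ((hzero j).eq_of_tgt _ _)
  have hmono : Mono (HomologicalComplex.homologyMap S.f j) := by
    by_cases! hj : ∃ i, c.Rel i j
    · obtain ⟨i, hij⟩ := hj
      exact (hS.homology_exact₁ i j hij).mono_g ((hzero i).eq_of_src _ _)
    · have := hS.mono_f
      exact HomologicalComplex.mono_homologyMap_of_mono_of_not_rel S.f j hj
  exact isIso_of_mono_of_epi _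

/-- The hypothesis says that the relative cycles are relative boundaries, that is, that the
cokernel of `φ` is acyclic. -/
lemma quasiIso_of_mono_of_exists_eq_add_d {R : Type u} [Ring R] {ι : Type*} {c : ComplexShape ι}
    {K L : HomologicalComplex (ModuleCat.{w} R) c} (φ : K ⟶ L) [Mono φ]
    (h : ∀ i j k, c.prev j = i → c.next j = k → ∀ (y : L.X j) (x : K.X k),
      L.d j k y = φ.f k x → ∃ (x' : K.X j) (z : L.X i), y = φ.f j x' + L.d i j z) :
    QuasiIso φ := by
  let S := ShortComplex.mk φ (Limits.cokernel.π φ) (Limits.cokernel.condition φ)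
  have hS : S.ShortExact := { exact := ShortComplex.exact_cokernel φ }
  have hSdeg (j : ι) : (S.map (HomologicalComplex.eval _ c j)).ShortExact :=
    HomologicalComplex.shortExact_iff_degreewise_shortExact S |>.1 hS j
  have hπd (i j : ι) (y : L.X i) : S.X₃.d i j (S.g.f i y) = S.g.f j (L.d i j y) := by
    rw [← ConcreteCategory.comp_apply, S.g.comm, ConcreteCategory.comp_apply]
  have hπφ (j : ι) (x : K.X j) : S.g.f j (φ.f j x) = 0 := by
    rw [← ConcreteCategory.comp_apply, ← HomologicalComplex.comp_f, S.zero]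
    rfl
  refine quasiIso_f_of_acyclic_X₃ hS fun j => ?_
  rw [HomologicalComplex.exactAt_iff, ShortComplex.moduleCat_exact_iff]
  intro q hq
  obtain ⟨y, rfl⟩ := (hSdeg j).moduleCat_surjective_g q
  obtain ⟨x, hx⟩ := (ShortComplex.moduleCat_exact_iff _).1 (hSdeg (c.next j)).exact
    (L.d j (c.next j) y) ((hπd _ _ y).symm.trans hq)
  obtain ⟨x', z, rfl⟩ := h _ j _ rfl rfl y x hx.symm
  refine ⟨S.g.f _ z, (hπd _ _ z).trans ?_⟩
  change S.g.f j (L.d _ j z) = S.g.f j (φ.f j x' + L.d _ j z)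
  rw [map_add, hπφ, zero_add]

lemma exactAt_succ_iff_function_exact {R : Type u} [Ring R]
    (K : ChainComplex (ModuleCat.{w} R) ℕ) (n : ℕ) :
    K.ExactAt (n + 1) ↔ Function.Exact (K.d (n + 2) (n + 1)) (K.d (n + 1) n) := by
  rw [HomologicalComplex.exactAt_iff' _ (n + 2) (n + 1) n (by simp) (by simp)]
  exact ShortComplex.ShortExact.moduleCat_exact_iff_function_exact _

end Homology

section Subcomplex

variable {R : Type u} [CommRing R] {V : Type v} {M N : ∀ n, Submodule R (Tuples R V n)}
  {hM : ∀ n, ∀ a ∈ M (n + 1), boundary R n a ∈ M n}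
  {hN : ∀ n, ∀ a ∈ N (n + 1), boundary R n a ∈ N n}

lemma subcomplex_d (n : ℕ) :
    (subcomplex R M hM).d (n + 1) n = ModuleCat.ofHom ((boundary R n).restrict (hM n)) := by
  dsimp only [subcomplex]
  rw [ChainComplex.of_d]

/-- The inclusion of a `∂`-stable family of submodules of the modules of elementary paths into a
larger one, as a morphism of chain complexes. -/
noncomputable def subcomplexInclusion (h : ∀ n, M n ≤ N n) :
    subcomplex R M hM ⟶ subcomplex R N hN :=
  ChainComplex.ofHom (fun n => ModuleCat.ofHom (Submodule.inclusion (h n))) fun n => by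
    rw [subcomplex_d, subcomplex_d]
    rfl

instance (h : ∀ n, M n ≤ N n) :
    Mono (subcomplexInclusion h : subcomplex R M hM ⟶ subcomplex R N hN) :=
  HomologicalComplex.mono_of_mono_f _ fun n =>
    (ModuleCat.mono_iff_injective _).2 (Submodule.inclusion_injective (h n))

lemma quasiIso_subcomplexInclusion (h : ∀ n, M n ≤ N n)
    (h₀ : N 0 ≤ M 0 ⊔ (N 1).map (boundary R 0))
    (h₁ : ∀ n, N (n + 1) ⊓ (M n).comap (boundary R n) ≤
      M (n + 1) ⊔ (N (n + 2)).map (boundary R (n + 1))) :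
    QuasiIso (subcomplexInclusion h : subcomplex R M hM ⟶ subcomplex R N hN) := by
  have hlift {n : ℕ} (y : N n) (hy : y.1 ∈ M n ⊔ (N (n + 1)).map (boundary R n)) :
      ∃ (x : M n) (z : N (n + 1)),
        y = Submodule.inclusion (h n) x + (boundary R n).restrict (hN n) z := by
    obtain ⟨x, hx, -, ⟨z, hz, rfl⟩, hxz⟩ := Submodule.mem_sup.1 hy
    exact ⟨⟨x, hx⟩, ⟨z, hz⟩, Subtype.ext hxz.symm⟩
  refine quasiIso_of_mono_of_exists_eq_add_d _ ?_
  intro i j k hi hk y x hyx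
  rw [ChainComplex.prev] at hi
  subst hi
  rw [subcomplex_d]
  cases j with
  | zero => exact hlift y (h₀ y.2)
  | succ n =>
    rw [ChainComplex.next_nat_succ] at hk
    subst hk
    rw [subcomplex_d] at hyx
    have hyx' : boundary R n y.1 = x.1 := congrArg Subtype.val hyx
    exact hlift y (h₁ n ⟨y.2, Submodule.mem_comap.2 (hyx' ▸ x.2)⟩)

end Subcomplex

section Lattice

/-- By the modular law, `hstep` improves to `F (l + 1) ⊓ Z ≤ F l ⊓ Z ⊔ B`, which can be iterated
down to `F p`. -/
lemma iSup_inf_le_inf_sup {α : Type*} [CompleteLattice α] [IsCompactlyGenerated α]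
    [IsModularLattice α] {F : ℕ → α} (hF : Monotone F) {Z B : α} (hBZ : B ≤ Z) (p : ℕ)
    (hstep : ∀ l ≥ p, F (l + 1) ⊓ Z ≤ F l ⊔ B) : (⨆ l, F l) ⊓ Z ≤ F p ⊓ Z ⊔ B := by
  have hstep' (l : ℕ) (hl : p ≤ l) : F (l + 1) ⊓ Z ≤ F l ⊓ Z ⊔ B :=
    calc F (l + 1) ⊓ Z ≤ (B ⊔ F l) ⊓ Z :=
          le_inf ((hstep l hl).trans_eq (sup_comm _ _)) inf_le_right
      _ = B ⊔ F l ⊓ Z := sup_inf_assoc_of_le _ hBZ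
      _ = F l ⊓ Z ⊔ B := sup_comm _ _
  have hle (l : ℕ) (hl : p ≤ l) : F l ⊓ Z ≤ F p ⊓ Z ⊔ B := by
    induction l, hl using Nat.le_induction with
    | base => exact le_sup_left
    | succ l hl ih => exact (hstep' l hl).trans (sup_le ih le_sup_right)
  rw [hF.directed_le.iSup_inf_eq]
  refine iSup_le fun l => ?_
  calc F l ⊓ Z ≤ F (max p l) ⊓ Z := inf_le_inf_right Z (hF (le_max_right p l))
    _ ≤ F p ⊓ Z ⊔ B := hle _ (le_max_left p l)

end Lattice

section Length

lemma sum_le_card_iff {ι : Type*} {s : Finset ι} {f : ι → ℕ∞} (hf : ∀ i ∈ s, 1 ≤ f i) :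
    ∑ i ∈ s, f i ≤ s.card ↔ ∀ i ∈ s, f i ≤ 1 := by
  classical
  refine ⟨fun h i hi => ?_, fun h => by simpa using Finset.sum_le_card_nsmul s f 1 h⟩
  have hrest : ((s.erase i).card : ℕ∞) ≤ ∑ j ∈ s.erase i, f j := by
    simpa using Finset.card_nsmul_le_sum _ f 1 fun j hj => hf j (Finset.mem_of_mem_erase hj)
  refine (ENat.add_le_add_iff_right (ENat.natCast_ne_top (s.erase i).card)).1 ?_
  calc f i + (s.erase i).card ≤ f i + ∑ j ∈ s.erase i, f j := by gcongr
    _ = ∑ j ∈ s, f j := Finset.add_sum_erase s f hi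
    _ ≤ s.card := h
    _ = 1 + (s.erase i).card := by
      rw [← Finset.card_erase_add_one hi, Nat.cast_add, Nat.cast_one, add_comm]

variable {V : Type v} (G : Digraph V)

lemma dist_ne_top_iff {x y : V} : dist G x y ≠ ⊤ ↔ Reaches G x y := by
  simp [dist, Reaches, iInf_eq_top]

lemma dist_le_one_iff {x y : V} (hxy : x ≠ y) : dist G x y ≤ 1 ↔ G.Adj x y := by
  refine ⟨fun h => ?_, fun h => ?_⟩
  · obtain ⟨n, hwalk, hdist⟩ := exists_hasWalk G (ne_top_of_le_ne_top ENat.one_ne_top h)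
    have hn : n ≤ 1 := by exact_mod_cast hdist ▸ h
    cases hwalk with
    | nil => exact absurd rfl hxy
    | cons hadj htail =>
      cases htail with
      | nil => exact hadj
      | cons => omega
  · exact_mod_cast iInf₂_le (f := fun (n : ℕ) (_ : HasWalk G n x y) => (n : ℕ∞)) 1
      (.cons h (.nil y))

lemma len_ne_top_iff {n : ℕ} (x : Fin (n + 1) → V) :
    len G x ≠ ⊤ ↔ ∀ i j, i < j → Reaches G (x i) (x j) := by
  have : IsTrans V (Reaches G) := ⟨fun _ _ _ ⟨m, hm⟩ ⟨n, hn⟩ => ⟨m + n, hm.trans G hn⟩⟩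
  refine Iff.trans ?_ (Fin.liftFun_iff_succ (Reaches G) (f := x)).symm
  simp [len, ENat.sum_eq_top, ← dist_ne_top_iff]

lemma len_le_iff_adj {n : ℕ} {x : Fin (n + 1) → V} (hx : Function.Injective x) :
    len G x ≤ n ↔ ∀ i : Fin n, G.Adj (x i.castSucc) (x i.succ) := by
  have hne (i : Fin n) : x i.castSucc ≠ x i.succ := hx.ne Fin.castSucc_lt_succ.ne
  have hsum := sum_le_card_iff (s := Finset.univ) fun i _ =>
    Order.one_le_iff_pos.2 (dist_pos G (hne i))
  simpa [len, dist_le_one_iff G (hne _)] using hsum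

/-- The `l`-th stage of the filtration of the complex of injective words by length: the injective
words of length at most `l`. Length `∞` is excluded at every stage, so these words automatically
satisfy the reachability condition of `injWords`. -/
def wordsOfLenLE (l : ℕ) : OrderedComplex V where
  simplices _ := {x | Function.Injective x ∧ len G x ≤ l}
  injective _ _ hx := hx.1
  face_mem _ x hx i :=
    ⟨hx.1.comp Fin.succAbove_right_injective, (len_face_le G i x).trans hx.2⟩

lemma wordsOfLenLE_mono (n : ℕ) : Monotone fun l => (wordsOfLenLE G l).simplices n :=
  fun _ _ hlm _ hx => ⟨hx.1, hx.2.trans (by exact_mod_cast hlm)⟩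

lemma wordsOfLenLE_self (n : ℕ) : (wordsOfLenLE G n).simplices n = allowedPaths G n :=
  Set.ext fun _ => and_congr_right fun hx => len_le_iff_adj G hx

lemma eulerianTuples_subset_wordsOfLenLE (l n : ℕ) :
    eulerianTuples G n l ⊆ (wordsOfLenLE G l).simplices n :=
  fun _ hx => ⟨hx.1, hx.2.le⟩

lemma iUnion_wordsOfLenLE (n : ℕ) :
    ⋃ l, (wordsOfLenLE G l).simplices n = (injWords G).simplices n := by
  ext x
  simp only [wordsOfLenLE, injWords, Set.mem_iUnion, Set.mem_ofPred_eq, exists_and_left,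
    ← len_ne_top_iff]
  exact and_congr_right fun _ =>
    ⟨fun ⟨l, hl⟩ => ne_top_of_le_ne_top (ENat.natCast_ne_top l) hl,
      fun h => ⟨_, (ENat.natCast_toNat h).ge⟩⟩

end Length

section Chains

variable {V : Type v} (R : Type u) [CommRing R]

/-- The free `R`-module on the `n`-simplices of `K`, as a submodule of the elementary `n`-paths. -/
abbrev OrderedComplex.chainModule (K : OrderedComplex V) (n : ℕ) : Submodule R (Tuples R V n) :=
  Finsupp.supported R R (K.simplices n)

lemma map_boundary_le_comap_boundary {n : ℕ} (P : Submodule R (Tuples R V (n + 2)))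
    (Q : Submodule R (Tuples R V n)) :
    P.map (boundary R (n + 1)) ≤ Q.comap (boundary R n) := by
  rintro _ ⟨a, -, rfl⟩
  rw [Submodule.mem_comap, boundary_boundary]
  exact Q.zero_mem

variable (G : Digraph V)

lemma chainModule_wordsOfLenLE_mono (n : ℕ) :
    Monotone fun l => (wordsOfLenLE G l).chainModule R n :=
  fun _ _ hlm => Finsupp.supported_mono (wordsOfLenLE_mono G n hlm)

lemma iSup_chainModule_wordsOfLenLE (n : ℕ) :
    ⨆ l, (wordsOfLenLE G l).chainModule R n = (injWords G).chainModule R n := by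
  rw [← Finsupp.supported_iUnion, iUnion_wordsOfLenLE]

lemma chainModule_wordsOfLenLE_le (l n : ℕ) :
    (wordsOfLenLE G l).chainModule R n ≤ (injWords G).chainModule R n :=
  (le_iSup (fun l => (wordsOfLenLE G l).chainModule R n) l).trans_eq
    (iSup_chainModule_wordsOfLenLE R G n)

open Classical in
/-- The part of a chain supported on the tuples of distinct vertices of length exactly `l`. On the
`l`-th stage of the length filtration it is the projection onto the associated graded module
`EMC_{k,l}(G)`. -/
noncomputable def eulerianProj (l k : ℕ) :
    Tuples R V k →ₗ[R] Finsupp.supported R R (eulerianTuples G k l) :=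
  Finsupp.restrictDom R R (eulerianTuples G k l)

open Classical in
lemma eulerianProj_coe {l k : ℕ} (a : Finsupp.supported R R (eulerianTuples G k l)) :
    eulerianProj R G l k a = a :=
  LinearMap.congr_fun (Finsupp.restrictDom_comp_subtype _) a

variable {R G}

lemma lt_of_mem_support_sub_eulerianProj {l k : ℕ} {c : Tuples R V k}
    (hc : c ∈ (wordsOfLenLE G l).chainModule R k) {x : Fin (k + 1) → V}
    (hx : x ∈ (c - eulerianProj R G l k c).support) : len G x < l := by
  classical
  have hsplit : c - eulerianProj R G l k c = c.filter (· ∉ eulerianTuples G k l) :=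
    sub_eq_of_eq_add' (Finsupp.filter_add_filter_not c _).symm
  rw [hsplit, Finsupp.support_filter, Finset.mem_filter] at hx
  exact lt_of_le_of_ne (hc hx.1).2 fun h => hx.2 ⟨(hc hx.1).1, h⟩

lemma eulerianProj_eq_zero_iff {l k : ℕ} {c : Tuples R V k}
    (hc : c ∈ (wordsOfLenLE G (l + 1)).chainModule R k) :
    eulerianProj R G (l + 1) k c = 0 ↔ c ∈ (wordsOfLenLE G l).chainModule R k := by
  classical
  refine ⟨fun h x hx => ⟨(hc hx).1, ?_⟩, fun h => Subtype.ext ?_⟩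
  · have hlt := lt_of_mem_support_sub_eulerianProj hc (x := x) (by simpa [h] using hx)
    exact Order.le_of_lt_add_one (by exact_mod_cast hlt)
  · refine (Finsupp.filter_eq_zero_iff (· ∈ eulerianTuples G k (l + 1)) c).2 fun x hx => ?_
    by_contra hx'
    have hle := (h (Finsupp.mem_support_iff.2 hx')).2
    rw [hx.2] at hle
    exact (Nat.lt_succ_self l).not_ge (by exact_mod_cast hle)

lemma eulerianBoundary_eulerianProj {l k : ℕ} {c : Tuples R V (k + 1)}
    (hc : c ∈ (wordsOfLenLE G l).chainModule R (k + 1)) :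
    eulerianBoundary G R l k (eulerianProj R G l (k + 1) c) =
      eulerianProj R G l k (boundary R k c) := by
  have hlow := restrictDom_boundary_eq_zero G R l k (c - eulerianProj R G l (k + 1) c)
    fun x hx => lt_of_mem_support_sub_eulerianProj hc hx
  rw [map_sub, map_sub, sub_eq_zero] at hlow
  exact (eulerianBoundary_eq G R l k _).trans hlow.symm

variable (R G) in
lemma eulerianComplex_d (l k : ℕ) :
    (eulerianComplex G R l).d (k + 1) k = ModuleCat.ofHom (eulerianBoundary G R l k) := by
  dsimp only [eulerianComplex]
  rw [ChainComplex.of_d]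

lemma RegularlyDiagonal.exact_eulerianBoundary (hG : RegularlyDiagonal G R) {k l : ℕ}
    (hkl : k + 1 ≠ l) :
    Function.Exact (eulerianBoundary G R l (k + 1)) (eulerianBoundary G R l k) := by
  have hexact : (eulerianComplex G R l).ExactAt (k + 1) :=
    (HomologicalComplex.exactAt_iff_isZero_homology _ _).2 (hG (k + 1) l hkl)
  rw [exactAt_succ_iff_function_exact, eulerianComplex_d, eulerianComplex_d] at hexact
  exact hexact

lemma RegularlyDiagonal.wordsOfLenLE_succ_inf_comap_le (hG : RegularlyDiagonal G R) {k l : ℕ}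
    (hkl : k ≠ l) :
    (wordsOfLenLE G (l + 1)).chainModule R (k + 1) ⊓
        ((wordsOfLenLE G l).chainModule R k).comap (boundary R k) ≤
      (wordsOfLenLE G l).chainModule R (k + 1) ⊔
        ((wordsOfLenLE G (l + 1)).chainModule R (k + 2)).map (boundary R (k + 1)) := by
  rintro c ⟨hc, hdc⟩
  rw [SetLike.mem_coe, Submodule.mem_comap] at hdc
  have hcycle : eulerianBoundary G R (l + 1) k (eulerianProj R G (l + 1) (k + 1) c) = 0 := by
    rw [eulerianBoundary_eulerianProj hc,
      eulerianProj_eq_zero_iff ((wordsOfLenLE G (l + 1)).boundary_mem R k c hc)]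
    exact hdc
  obtain ⟨b, hb⟩ := (hG.exact_eulerianBoundary (by omega) _).1 hcycle
  have hbmem : b.1 ∈ (wordsOfLenLE G (l + 1)).chainModule R (k + 2) :=
    Finsupp.supported_mono (eulerianTuples_subset_wordsOfLenLE G _ _) b.2
  have hlow : c - boundary R (k + 1) b ∈ (wordsOfLenLE G l).chainModule R (k + 1) := by
    rw [← eulerianProj_eq_zero_iff
      (Submodule.sub_mem _ hc ((wordsOfLenLE G (l + 1)).boundary_mem R _ _ hbmem)), map_sub, ← hb,
      ← eulerianBoundary_eulerianProj hbmem, eulerianProj_coe, sub_self]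
  rw [← sub_add_cancel c (boundary R (k + 1) b)]
  exact Submodule.add_mem_sup hlow (Submodule.mem_map_of_mem hbmem)

lemma RegularlyDiagonal.injWords_inf_comap_le (hG : RegularlyDiagonal G R) (n : ℕ) :
    (injWords G).chainModule R (n + 1) ⊓
        (Finsupp.supported R R (allowedPaths G n)).comap (boundary R n) ≤
      regularPaths G R (n + 1) ⊔
        ((injWords G).chainModule R (n + 2)).map (boundary R (n + 1)) := by
  rw [← iSup_chainModule_wordsOfLenLE, regularPaths, ← wordsOfLenLE_self G (n + 1),
    ← wordsOfLenLE_self G n]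
  refine iSup_inf_le_inf_sup (chainModule_wordsOfLenLE_mono R G (n + 1))
    (map_boundary_le_comap_boundary R _ _) (n + 1) fun l hl => ?_
  calc _ ≤ (wordsOfLenLE G (l + 1)).chainModule R (n + 1) ⊓
        ((wordsOfLenLE G l).chainModule R n).comap (boundary R n) :=
        inf_le_inf_left _ (Submodule.comap_mono (chainModule_wordsOfLenLE_mono R G n (by omega)))
    _ ≤ (wordsOfLenLE G l).chainModule R (n + 1) ⊔
        ((wordsOfLenLE G (l + 1)).chainModule R (n + 2)).map (boundary R (n + 1)) :=
        hG.wordsOfLenLE_succ_inf_comap_le (by omega)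
    _ ≤ _ := sup_le_sup_left (Submodule.map_mono (chainModule_wordsOfLenLE_le R G _ _)) _

variable (R G)

lemma regularPaths_le_allowedPaths (n : ℕ) :
    regularPaths G R n ≤ Finsupp.supported R R (allowedPaths G n) := by
  cases n with
  | zero => exact le_rfl
  | succ n => exact inf_le_left

lemma regularPaths_le_injWords (n : ℕ) :
    regularPaths G R n ≤ (injWords G).chainModule R n := by
  refine (regularPaths_le_allowedPaths R G n).trans ?_
  rw [← wordsOfLenLE_self]
  exact chainModule_wordsOfLenLE_le R G n n

/-- The inclusion of the regular path complex into the chains of the complex of injective words,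
which induces the isomorphism on homology. -/
noncomputable def regularPathInclusion :
    regularPathComplex G R ⟶ (injWords G).chains R :=
  subcomplexInclusion (regularPaths_le_injWords R G)

lemma dirFlag_reachPre : dirFlag (reachPre G) = injWords G := rfl

end Chains

end EulerianMagnitude

open EulerianMagnitude in
theorem mainTheorem3_general {R : Type*} [CommRing R] {V : Type*} (G : Digraph V)
    (hdiag : RegularlyDiagonal G R) : QuasiIso (regularPathInclusion R G) := by
  refine quasiIso_subcomplexInclusion _ ?_ fun n => ?_
  · refine le_sup_of_le_left (Finsupp.supported_mono fun x hx => ⟨hx.1, ?_⟩)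
    exact fun i => i.elim0
  · exact (inf_le_inf_left _ (Submodule.comap_mono (regularPaths_le_allowedPaths R G n))).trans
      (hdiag.injWords_inf_comap_le n)

theorem mainTheorem3 {R : Type*} [CommRing R] {V : Type*} [Finite V] (G : Digraph V)
    (hconn : G.toSimpleGraphInclusive.Connected)
    (hdiag : EulerianMagnitude.RegularlyDiagonal G R) (n : ℕ) :
    Nonempty ((EulerianMagnitude.regularPathComplex G R).homology n ≅
        ((EulerianMagnitude.injWords G).chains R).homology n) ∧
      Nonempty ((EulerianMagnitude.regularPathComplex G R).homology n ≅
        ((EulerianMagnitude.dirFlag (EulerianMagnitude.reachPre G)).chains R).homology n) := by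
  have := mainTheorem3_general G hdiag
  rw [EulerianMagnitude.dirFlag_reachPre, and_self]
  exact ⟨isoOfQuasiIsoAt (EulerianMagnitude.regularPathInclusion R G) n⟩
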